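/- Let $(\Omega,\mu)$ be a $\sigma$-finite non-atomic measure space and let $\mathcal M(\Omega,\mu)$ be the space of ($\mu$-a.e. classes of) real- or complex-valued $\mu$-measurable functions on $\Omega$. For $f\in\mathcal M(\Omega,\mu)$ and $t>0$ put $$f^*(t)=\inf\{s\ge 0:\mu(\{|f|>s\})\le t\},\qquad f^{**}(t)=\frac1t\int_0^t f^*(u)\,du .$$ For an interval $I\subset(0,\infty)$, $\|\cdot\|_{q,I}$ is the (quasi-)norm of $L_q(I)$ with respect to Lebesgue measure, and $1/\infty=0$, $1/0=\infty$. A positive Lebesgue measurable function $b:(0,\infty)\to(0,\infty)$ is \emph{slowly varying} if for every $\varepsilon>0$ the function $t^{\varepsilon}b(t)$ is equivalent (up to multiplicative constants) to an increasing function on $(0,\infty)$ and $t^{-\varepsilon}b(t)$ is equivalent to a decreasing one. Let $L_1,L_\infty$ be the Lebesgue spaces on $(\Omega,\mu)$ and let $L_{1,\infty}$ be the space of all $f\in\mathcal M(\Omega,\mu)$ with $\|f\|_{1,\infty}=\|t f^*(t)\|_{\infty,(0,\infty)}<\infty$. For $A_0\in\{L_1,L_{1,\infty}\}$, $A_1=L_\infty$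 and $f\in A_0+A_1$ let $$K(t,f)=K(t,f;A_0,A_1)=\inf\{\|f_0\|_{A_0}+t\|f_1\|_{A_1}: f=f_0+f_1,\ f_i\in A_i\}\quad(t>0),$$ and let $(A_0,A_1)^{\mathcal L}_{\theta,r,b,q,a}$ be the space of all $f\in A_0+A_1$ with $$\Big\|t^{-1/r}b(t)\,\big\|u^{-\theta-1/q}a(u)K(u,f)\big\|_{q,(0,t)}\Big\|_{r,(0,\infty)}<\infty .$$ Let $L^{\mathcal L}_{p,r,b,q,a}$ be the space of all $f\in\mathcal M(\Omega,\mu)$ with $$\Big\|t^{-1/r}b(t)\,\big\|u^{1/p-1/q}a(u)f^{*}(u)\big\|_{q,(0,t)}\Big\|_{r,(0,\infty)}<\infty ,$$ let $(L)^{\mathcal L}_{p,r,b,q,a}$ be defined in the same way with $f^{**}$ in place of $f^*$, and let $L^{(p,q,r}_b$ and $(L)^{(p,q,r}_b$ be the small Lorentz--Karamata spaces, defined by the same two expressions without the factor $a(u)$. Equality of two of these spaces means that they have the same elements and equivalent quasi-norms. \textbf{Theorem.} Let $0<\theta\le 1$, $p=\frac1{1-\theta}$ (so $p=\infty$ if $\theta=1$),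 $0<q,r\le\infty$, and let $a,b$ be slowly varying. Then $$(L_1,L_\infty)^{\mathcal L}_{\theta,r,b,q,a}=(L_{1,\infty},L_\infty)^{\mathcal L}_{\theta,r,b,q,a}=(L)^{\mathcal L}_{p,r,b,q,a}=L^{\mathcal L}_{p,r,b,q,a}.$$ In particular, $$(L_1,L_\infty)^{\mathcal L}_{\theta,r,b,q,1}=(L_{1,\infty},L_\infty)^{\mathcal L}_{\theta,r,b,q,1}=(L)^{(p,q,r}_{b}=L^{(p,q,r}_{b}.$$ -/

import Mathlib

open MeasureTheory Set
open scoped ENNReal NNReal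

noncomputable section

namespace LimitInterp

/-- `μ` has no atoms: every measurable set of positive measure splits into two measurable parts of
positive measure. -/
def IsNonatomic {Ω : Type*} [MeasurableSpace Ω] (μ : Measure Ω) : Prop :=
  ∀ s, MeasurableSet s → 0 < μ s → ∃ t, t ⊆ s ∧ MeasurableSet t ∧ 0 < μ t ∧ 0 < μ (s \ t)

/-- Two positive functions on `(0,∞)` are equivalent: `C⁻¹ ψ ≤ φ ≤ C ψ` for some constant `C`. -/
def EquivOnPos (φ ψ : ℝ → ℝ) : Prop :=
  ∃ C : ℝ, 0 < C ∧ ∀ t, 0 < t → φ t ≤ C * ψ t ∧ ψ t ≤ C * φ t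

/-- Slowly varying functions on `(0,∞)` (values outside `(0,∞)` are irrelevant). -/
structure IsSlowlyVarying (b : ℝ → ℝ) : Prop where
  /-- `b` is positive and finite. -/
  pos : ∀ t, 0 < t → 0 < b t
  /-- `b` is Lebesgue measurable on `(0,∞)`. -/
  aemeasurable : AEMeasurable b (volume.restrict (Ioi 0))
  /-- `t ^ ε * b t` is equivalent to an increasing function. -/
  equiv_increasing : ∀ ε : ℝ, 0 < ε →
    ∃ φ : ℝ → ℝ, MonotoneOn φ (Ioi 0) ∧ EquivOnPos (fun t => t ^ ε * b t) φ
  /-- `t ^ (-ε) * b t` is equivalent to a decreasing function. -/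
  equiv_decreasing : ∀ ε : ℝ, 0 < ε →
    ∃ φ : ℝ → ℝ, AntitoneOn φ (Ioi 0) ∧ EquivOnPos (fun t => t ^ (-ε) * b t) φ

/-- The reciprocal `1/q` as a real number, with `1/∞ = 0` (only used for `q ≠ 0`). -/
def recip (q : ℝ≥0∞) : ℝ := (q⁻¹).toReal

/-- The (quasi-)norm `‖g‖_{q,I}` of `L_q(I)` of a nonnegative function `g`, for `I ⊆ ℝ`. -/
def normOn (q : ℝ≥0∞) (I : Set ℝ) (g : ℝ → ℝ≥0∞) : ℝ≥0∞ :=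
  eLpNorm g q (volume.restrict I)

/-- The weight `t ^ α * b t`. -/
def weight (α : ℝ) (b : ℝ → ℝ) (t : ℝ) : ℝ≥0∞ := ENNReal.ofReal (t ^ α * b t)

/-- A space inside an ambient space `V`: its set of elements and its (quasi-)norm. -/
structure FnSpace (V : Type*) where
  /-- The elements of the space. -/
  carrier : Set V
  /-- The quasi-norm; only its values on `carrier` matter. -/
  qnorm : V → ℝ≥0∞

/-- The space of all elements of `V` on which `N` is finite. -/
def FnSpace.ofQNorm {V : Type*} (N : V → ℝ≥0∞) : FnSpace V where
  carrier := {f | N f < ∞}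
  qnorm := N

/-- Continuous embedding `X ⊂ Y`. -/
def FnSpace.Embeds {V : Type*} (X Y : FnSpace V) : Prop :=
  X.carrier ⊆ Y.carrier ∧ ∃ C : ℝ≥0, ∀ f ∈ X.carrier, Y.qnorm f ≤ C * X.qnorm f

/-- Equality of spaces in the sense of interpolation theory: same elements, equivalent
quasi-norms. -/
def FnSpace.Same {V : Type*} (X Y : FnSpace V) : Prop := X.Embeds Y ∧ Y.Embeds X

section Interpolation

variable {V : Type*} [AddCommGroup V]

/-- The elements of the sum `A₀ + A₁`. -/
def sumSet (A₀ A₁ : FnSpace V) : Set V :=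
  {f | ∃ f₀ ∈ A₀.carrier, ∃ f₁ ∈ A₁.carrier, f = f₀ + f₁}

/-- The Peetre `K`-functional `K(t,f;A₀,A₁)` (for `t > 0`). -/
def peetreK (A₀ A₁ : FnSpace V) (t : ℝ) (f : V) : ℝ≥0∞ :=
  ⨅ (f₀ ∈ A₀.carrier) (f₁ ∈ A₁.carrier) (_ : f = f₀ + f₁),
    A₀.qnorm f₀ + ENNReal.ofReal t * A₁.qnorm f₁

/-- The quasi-norm of the `𝓛` limiting interpolation space:
`‖ t^{-1/r} b(t) ‖ u^{-θ-1/q} a(u) K(u,f) ‖_{q,(0,t)} ‖_{r,(0,∞)}`. -/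
def interpLNorm (A₀ A₁ : FnSpace V) (θ : ℝ) (r : ℝ≥0∞) (b : ℝ → ℝ) (q : ℝ≥0∞) (a : ℝ → ℝ)
    (f : V) : ℝ≥0∞ :=
  normOn r (Ioi 0) fun t => weight (-recip r) b t *
    normOn q (Ioo 0 t) fun u => weight (-θ - recip q) a u * peetreK A₀ A₁ u f

/-- The `𝓛` limiting interpolation space `(A₀,A₁)^𝓛_{θ,r,b,q,a}`. -/
def interpL (A₀ A₁ : FnSpace V) (θ : ℝ) (r : ℝ≥0∞) (b : ℝ → ℝ) (q : ℝ≥0∞) (a : ℝ → ℝ) :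
    FnSpace V where
  carrier := {f ∈ sumSet A₀ A₁ | interpLNorm A₀ A₁ θ r b q a f < ∞}
  qnorm := interpLNorm A₀ A₁ θ r b q a

end Interpolation

section FunctionSpaces

variable {Ω : Type*} [MeasurableSpace Ω] {μ : Measure Ω} {𝕜 : Type*} [RCLike 𝕜]

/-- The non-increasing rearrangement `f*(t) = inf {s ≥ 0 : μ {|f| > s} ≤ t}` (`inf ∅ = ∞`). -/
def rearr (f : Ω →ₘ[μ] 𝕜) (t : ℝ) : ℝ≥0∞ :=
  sInf {s : ℝ≥0∞ | μ {x | s < ‖f x‖ₑ} ≤ ENNReal.ofReal t}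

/-- The maximal function `f**(t) = (1/t) ∫₀ᵗ f*(u) du` of `f*`. -/
def maxRearr (f : Ω →ₘ[μ] 𝕜) (t : ℝ) : ℝ≥0∞ :=
  (ENNReal.ofReal t)⁻¹ * ∫⁻ u in Ioo 0 t, rearr f u

variable (μ 𝕜)

/-- The Lebesgue space `L_p` on `(Ω,μ)`. -/
def lebesgue (p : ℝ≥0∞) : FnSpace (Ω →ₘ[μ] 𝕜) := .ofQNorm fun f => eLpNorm f p μ

/-- The Lorentz–Karamata space `L_{p,q;a}`. -/
def lorentzKaramata (p q : ℝ≥0∞) (a : ℝ → ℝ) : FnSpace (Ω →ₘ[μ] 𝕜) := .ofQNorm fun f =>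
  normOn q (Ioi 0) fun t => weight (recip p - recip q) a t * rearr f t

/-- The weak Lebesgue space `L_{1,∞}`. -/
def weakL1 : FnSpace (Ω →ₘ[μ] 𝕜) := lorentzKaramata μ 𝕜 1 ∞ (fun _ => 1)

/-- The space `L^𝓛_{p,r,b,q,a}`, defined through `f*`. -/
def lorentzL (p r : ℝ≥0∞) (b : ℝ → ℝ) (q : ℝ≥0∞) (a : ℝ → ℝ) : FnSpace (Ω →ₘ[μ] 𝕜) :=
  .ofQNorm fun f => normOn r (Ioi 0) fun t => weight (-recip r) b t *
    normOn q (Ioo 0 t) fun u => weight (recip p - recip q) a u * rearr f u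

/-- The space `(L)^𝓛_{p,r,b,q,a}`, defined through `f**`. -/
def maxLorentzL (p r : ℝ≥0∞) (b : ℝ → ℝ) (q : ℝ≥0∞) (a : ℝ → ℝ) : FnSpace (Ω →ₘ[μ] 𝕜) :=
  .ofQNorm fun f => normOn r (Ioi 0) fun t => weight (-recip r) b t *
    normOn q (Ioo 0 t) fun u => weight (recip p - recip q) a u * maxRearr f u

/-- The small Lorentz–Karamata space `L^{(p,q,r}_b`, defined through `f*`. -/
def smallStar (p q r : ℝ≥0∞) (b : ℝ → ℝ) : FnSpace (Ω →ₘ[μ] 𝕜) :=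
  .ofQNorm fun f => normOn r (Ioi 0) fun t => weight (-recip r) b t *
    normOn q (Ioo 0 t) fun u => ENNReal.ofReal (u ^ (recip p - recip q)) * rearr f u

/-- The small Lorentz–Karamata space `(L)^{(p,q,r}_b`, defined through `f**`. -/
def smallStarStar (p q r : ℝ≥0∞) (b : ℝ → ℝ) : FnSpace (Ω →ₘ[μ] 𝕜) :=
  .ofQNorm fun f => normOn r (Ioi 0) fun t => weight (-recip r) b t *
    normOn q (Ioo 0 t) fun u => ENNReal.ofReal (u ^ (recip p - recip q)) * maxRearr f u

end FunctionSpaces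

end LimitInterp

end

/-!
The pointwise estimates
`t f*(t) ≤ K(t,f;L_{1,∞},L_∞) ≤ C K(t,f;L_1,L_∞) ≤ 2 C t f**(t)`
(the last one from truncating `f` at the level `f*(t)`) reduce the theorem to the embedding of the
space defined by `f*` into the one defined by `f**`, which closes a cycle of four embeddings. That
embedding is Hardy's inequality for decreasing functions on `(0,t)` with a constant independent of
`t`. Splitting `(0,u)` dyadically bounds `u^β f**(u)` by a series of dilates of `u^β f*(u)` whose
quasi-norms decay geometrically, so the inequality holds for every `q > 0`; the weight `a` is
absorbed because `u^{-ε} a(u)` is equivalent to a decreasing function.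
-/

noncomputable section

namespace LimitInterp

section QuasiNorms

variable {α : Type*} [MeasurableSpace α] {q : ℝ≥0∞}

theorem eLpNorm_iSup_rpow_le {ι : Type*} [Countable ι] (hq₀ : q ≠ 0) (hq : q ≠ ∞) {μ : Measure α}
    {g : ι → α → ℝ≥0∞} (hg : ∀ i, AEMeasurable (g i) μ) :
    eLpNorm (fun x => ⨆ i, g i x) q μ ^ q.toReal ≤ ∑' i, eLpNorm (g i) q μ ^ q.toReal := by
  lift q to ℝ≥0 using hq
  have hq_pos : 0 < (q : ℝ) := NNReal.coe_pos.2 (pos_of_ne_zero (by simpa using hq₀))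
  simp only [ENNReal.coe_toReal, eLpNorm_nnreal_pow_eq_lintegral (by simpa using hq₀),
    enorm_eq_self]
  rw [← lintegral_tsum fun i => (hg i).pow_const _]
  gcongr with x
  calc (⨆ i, g i x) ^ (q : ℝ) = ⨆ i, g i x ^ (q : ℝ) :=
        (ENNReal.orderIsoRpow q hq_pos).map_iSup fun i => g i x
    _ ≤ ∑' i, g i x ^ (q : ℝ) := iSup_le fun i => ENNReal.le_tsum i

theorem exists_eLpNorm_iSup_le_of_geometric (hq₀ : q ≠ 0) {σ : ℝ≥0} (hσ : σ < 1) :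
    ∃ C : ℝ≥0, ∀ (μ : Measure α) (g : ℕ → α → ℝ≥0∞) (N : ℝ≥0∞), (∀ m, AEMeasurable (g m) μ) →
      (∀ m, eLpNorm (g m) q μ ≤ σ ^ m * N) → eLpNorm (fun x => ⨆ m, g m x) q μ ≤ C * N := by
  rcases eq_or_ne q ∞ with rfl | hq
  · refine ⟨1, fun μ g N _ hN => ?_⟩
    have hle : ∀ᵐ x ∂μ, ∀ m, g m x ≤ N := ae_all_iff.2 fun m => by
      filter_upwards [ae_le_eLpNormEssSup (f := g m) (μ := μ)] with x hx
      have hσm : (σ : ℝ≥0∞) ^ m ≤ 1 := pow_le_one₀ zero_le (by exact_mod_cast hσ.le)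
      exact (hx.trans (hN m)).trans (mul_le_of_le_one_left' hσm)
    simpa using eLpNormEssSup_le_of_ae_enorm_bound (hle.mono fun x hx => iSup_le hx)
  · have hQ : 0 < q.toReal := ENNReal.toReal_pos hq₀ hq
    set S : ℝ≥0∞ := ∑' m : ℕ, ((σ : ℝ≥0∞) ^ q.toReal) ^ m with hS_def
    have hS : S ≠ ∞ := by
      have : (σ : ℝ≥0∞) ^ q.toReal < 1 := ENNReal.rpow_lt_one (by exact_mod_cast hσ) hQ
      simpa [hS_def, ENNReal.tsum_geometric, tsub_eq_zero_iff_le] using this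
    refine ⟨(S ^ q.toReal⁻¹).toNNReal, fun μ g N hg hN => ?_⟩
    rw [ENNReal.coe_toNNReal (by finiteness), ← ENNReal.rpow_le_rpow_iff hQ]
    calc eLpNorm (fun x => ⨆ m, g m x) q μ ^ q.toReal
        ≤ ∑' m, eLpNorm (g m) q μ ^ q.toReal := eLpNorm_iSup_rpow_le hq₀ hq hg
      _ ≤ ∑' m : ℕ, ((σ : ℝ≥0∞) ^ q.toReal) ^ m * N ^ q.toReal := by
          refine ENNReal.tsum_le_tsum fun m => ?_
          calc eLpNorm (g m) q μ ^ q.toReal ≤ (σ ^ m * N) ^ q.toReal := by gcongr; exact hN m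
            _ = _ := by
              rw [ENNReal.mul_rpow_of_nonneg _ _ hQ.le, ← ENNReal.rpow_mul_natCast,
                ← ENNReal.rpow_natCast_mul, mul_comm q.toReal]
      _ = (S ^ q.toReal⁻¹ * N) ^ q.toReal := by
          rw [ENNReal.tsum_mul_right, ENNReal.mul_rpow_of_nonneg _ _ hQ.le,
            ENNReal.rpow_inv_rpow hQ.ne']

/-- Valid also for `q < 1`: writing `ρ < σ²`, the sum is at most `∑ σᵐ` times the supremum of
`σ⁻ᵐ gₘ`, so that the triangle inequality is not needed. -/
theorem exists_eLpNorm_tsum_le_of_geometric (hq₀ : q ≠ 0) {ρ : ℝ≥0} (hρ : ρ < 1) :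
    ∃ C : ℝ≥0, ∀ (μ : Measure α) (g : ℕ → α → ℝ≥0∞) (N : ℝ≥0∞), (∀ m, AEMeasurable (g m) μ) →
      (∀ m, eLpNorm (g m) q μ ≤ ρ ^ m * N) → eLpNorm (fun x => ∑' m, g m x) q μ ≤ C * N := by
  obtain ⟨σ, hρσ, hσ⟩ : ∃ σ : ℝ≥0, NNReal.sqrt ρ < σ ∧ σ < 1 :=
    exists_between (by rwa [← NNReal.sqrt_one, NNReal.sqrt_lt_sqrt])
  have hσ₀ : σ ≠ 0 := (pos_of_gt hρσ).ne'
  have hρσ' : σ⁻¹ * ρ ≤ σ := by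
    rw [inv_mul_le_iff₀ (pos_of_gt hρσ), ← sq]
    exact NNReal.sqrt_le_iff_le_sq.1 hρσ.le
  obtain ⟨C, hC⟩ := exists_eLpNorm_iSup_le_of_geometric (α := α) hq₀ hσ
  refine ⟨(1 - σ)⁻¹ * C, fun μ g N hg hN => ?_⟩
  have hgeom : ∑' m : ℕ, (σ : ℝ≥0∞) ^ m = ((1 - σ)⁻¹ : ℝ≥0) := by
    rw [ENNReal.tsum_geometric, ENNReal.coe_inv (tsub_pos_of_lt hσ).ne']
    simp
  set h : ℕ → α → ℝ≥0∞ := fun m x => (σ⁻¹ ^ m : ℝ≥0) * g m x with hh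
  have hsum : ∀ x, ∑' m, g m x ≤ ((1 - σ)⁻¹ : ℝ≥0) * ⨆ m, h m x := fun x => by
    rw [← hgeom, ← ENNReal.tsum_mul_right]
    refine ENNReal.tsum_le_tsum fun m => ?_
    calc g m x = σ ^ m * h m x := by
          rw [hh, ← mul_assoc, ← ENNReal.coe_pow, ← ENNReal.coe_mul, ← mul_pow,
            mul_inv_cancel₀ hσ₀, one_pow, ENNReal.coe_one, one_mul]
      _ ≤ σ ^ m * ⨆ m, h m x := by gcongr; exact le_iSup (fun m => h m x) m
  have hbound : ∀ m, eLpNorm (h m) q μ ≤ σ ^ m * N := fun m =>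
    calc eLpNorm (h m) q μ ≤ (σ⁻¹ ^ m : ℝ≥0) * eLpNorm (g m) q μ :=
          eLpNorm_le_mul_eLpNorm_of_ae_le_mul' (by simp [hh]) q
      _ ≤ (σ⁻¹ ^ m : ℝ≥0) * (ρ ^ m * N) := by gcongr; exact hN m
      _ = ((σ⁻¹ * ρ) ^ m : ℝ≥0) * N := by push_cast; rw [mul_pow, mul_assoc]
      _ ≤ σ ^ m * N := by rw [← ENNReal.coe_pow]; gcongr
  calc eLpNorm (fun x => ∑' m, g m x) q μ
      ≤ ((1 - σ)⁻¹ : ℝ≥0) * eLpNorm (fun x => ⨆ m, h m x) q μ :=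
        eLpNorm_le_mul_eLpNorm_of_ae_le_mul' (by simpa using Filter.Eventually.of_forall hsum) q
    _ ≤ ((1 - σ)⁻¹ : ℝ≥0) * (C * N) := by
        gcongr
        exact hC μ h N (fun m => (hg m).const_mul _) hbound
    _ = _ := by push_cast; ring

theorem normOn_le_mul {I : Set ℝ} (hI : MeasurableSet I) {g h : ℝ → ℝ≥0∞} (C : ℝ≥0)
    (hgh : ∀ t ∈ I, g t ≤ C * h t) : normOn q I g ≤ C * normOn q I h :=
  eLpNorm_le_mul_eLpNorm_of_ae_le_mul' (ae_restrict_of_forall_mem hI (by simpa using hgh)) q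

theorem exists_ne_top_of_normOn_lt_top (hq₀ : q ≠ 0) {I : Set ℝ} (hI : MeasurableSet I)
    (hvol : volume I ≠ 0) {g : ℝ → ℝ≥0∞} (hg : normOn q I g < ∞) : ∃ t ∈ I, g t ≠ ∞ := by
  by_contra! htop
  have hvol' : volume.restrict I ≠ 0 := by simpa using hvol
  have hle : eLpNorm (fun _ => (∞ : ℝ≥0∞)) q (volume.restrict I) ≤ normOn q I g :=
    eLpNorm_mono_enorm_ae (ae_restrict_of_forall_mem hI fun t ht => by simp [htop t ht])
  refine (hle.trans_lt hg).ne ?_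
  rw [eLpNorm_const _ hq₀ hvol', enorm_eq_self]
  exact ENNReal.top_mul (by simp [ENNReal.rpow_eq_zero_iff, hvol, ENNReal.toReal_nonneg])

theorem normOn_comp_mul_right {c : ℝ} (hc : 0 < c) (t : ℝ) (F : ℝ → ℝ≥0∞) :
    normOn q (Ioo 0 t) (fun u => F (u * c)) =
      ENNReal.ofReal (c ^ (-recip q)) * normOn q (Ioo 0 (t * c)) F := by
  have hemb : MeasurableEmbedding fun u : ℝ => u * c := measurableEmbedding_mulRight₀ hc.ne'
  have hmap : (volume.restrict (Ioo 0 t)).map (fun u => u * c) =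
      ENNReal.ofReal c⁻¹ • volume.restrict (Ioo 0 (t * c)) := by
    have hpre : (fun u => u * c) ⁻¹' Ioo 0 (t * c) = Ioo 0 t := by
      ext u
      simp only [mem_preimage, mem_Ioo, mul_pos_iff_of_pos_right hc, mul_lt_mul_iff_left₀ hc]
    rw [← hpre, ← hemb.restrict_map, Real.map_volume_mul_right hc.ne', Measure.restrict_smul,
      abs_of_pos (inv_pos.2 hc)]
  have hscale := eLpNorm_smul_measure_of_ne_zero (c := ENNReal.ofReal c⁻¹) (by simpa using hc) F q
    (volume.restrict (Ioo 0 (t * c)))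
  rw [← hmap, hemb.eLpNorm_map_measure, ENNReal.ofReal_rpow_of_pos (inv_pos.2 hc),
    Real.inv_rpow hc.le, ← Real.rpow_neg hc.le, one_div, smul_eq_mul] at hscale
  exact hscale

theorem ofReal_mul_le_normOn_top_of_antitoneOn {G : ℝ → ℝ≥0∞} (hG : AntitoneOn G (Ioi 0)) {t : ℝ}
    (ht : 0 < t) :
    ENNReal.ofReal t * G t ≤ normOn ∞ (Ioi 0) fun s => ENNReal.ofReal s * G s := by
  refine ENNReal.mul_le_of_forall_lt fun x hx y hy => ?_
  have hxt : x.toReal < t := ENNReal.toReal_lt_of_lt_ofReal hx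
  have hsub : Ioo x.toReal t ⊆ Ioi 0 := fun s hs => ENNReal.toReal_nonneg.trans_lt hs.1
  have : (ae (volume.restrict (Ioo x.toReal t))).NeBot := by
    rw [ae_neBot, Ne, Measure.restrict_eq_zero, Real.volume_Ioo]
    simpa using hxt
  have hae : ∀ᵐ s ∂volume.restrict (Ioo x.toReal t),
      ENNReal.ofReal s * G s ≤ normOn ∞ (Ioi 0) fun s => ENNReal.ofReal s * G s :=
    ae_mono (Measure.restrict_mono hsub le_rfl) <| by
      rw [normOn, eLpNorm_exponent_top]
      exact ae_le_eLpNormEssSup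
  obtain ⟨s, hle, hs⟩ := (hae.and (ae_restrict_mem measurableSet_Ioo)).exists
  calc x * y ≤ ENNReal.ofReal s * G t := by
        gcongr
        exact ((ENNReal.lt_ofReal_iff_toReal_lt hx.ne_top).2 hs.1).le
    _ ≤ ENNReal.ofReal s * G s := by
        gcongr
        exact hG (hsub hs) ht hs.2.le
    _ ≤ _ := hle

end QuasiNorms

section Hardy

/-- The Hardy operator: the mean of `G` over `(0,u)`. It turns `f*` into `f**`. -/
def hardyMean (G : ℝ → ℝ≥0∞) (u : ℝ) : ℝ≥0∞ :=
  (ENNReal.ofReal u)⁻¹ * ∫⁻ v in Ioo 0 u, G v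

/-- A function on `(0,∞)` that is equivalent to a decreasing one. -/
def IsAlmostDecreasing (g : ℝ → ℝ) : Prop :=
  ∃ φ : ℝ → ℝ, AntitoneOn φ (Ioi 0) ∧ EquivOnPos g φ

variable {G ψ : ℝ → ℝ≥0∞} {u : ℝ}

theorem ofReal_mul_hardyMean (G : ℝ → ℝ≥0∞) (hu : 0 < u) :
    ENNReal.ofReal u * hardyMean G u = ∫⁻ v in Ioo 0 u, G v :=
  ENNReal.mul_inv_cancel_left (by simpa using hu) ENNReal.ofReal_ne_top

theorem le_hardyMean (hG : AntitoneOn G (Ioi 0)) (hu : 0 < u) : G u ≤ hardyMean G u := by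
  rw [hardyMean, mul_comm, ← div_eq_mul_inv, ENNReal.le_div_iff_mul_le (by simp [hu]) (by simp)]
  calc G u * ENNReal.ofReal u = ∫⁻ _ in Ioo 0 u, G u := by simp
    _ ≤ ∫⁻ v in Ioo 0 u, G v :=
        setLIntegral_mono' measurableSet_Ioo fun v hv => hG hv.1 hu hv.2.le

theorem mul_hardyMean_le (hψ : AntitoneOn ψ (Ioi 0)) (G : ℝ → ℝ≥0∞) (hu : 0 < u) :
    ψ u * hardyMean G u ≤ hardyMean (fun v => ψ v * G v) u := by
  rw [hardyMean, hardyMean, mul_left_comm]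
  gcongr
  calc ψ u * ∫⁻ v in Ioo 0 u, G v ≤ ∫⁻ v in Ioo 0 u, ψ u * G v := lintegral_const_mul_le _ _
    _ ≤ ∫⁻ v in Ioo 0 u, ψ v * G v := setLIntegral_mono' measurableSet_Ioo fun v hv => by
        gcongr
        exact hψ hv.1 hu hv.2.le

theorem hardyMean_le_tsum (hG : AntitoneOn G (Ioi 0)) (hu : 0 < u) :
    hardyMean G u ≤
      ∑' m : ℕ, ENNReal.ofReal ((1 / 2) ^ (m + 1)) * G (u * (1 / 2) ^ (m + 1)) := by
  set d : ℕ → ℝ := fun m => u * (1 / 2) ^ m with hd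
  have hd_pos : ∀ m, 0 < d m := fun m => by positivity
  have hcover : Ioo 0 u ⊆ ⋃ m : ℕ, Ioc (d (m + 1)) (d m) := fun v hv => by
    obtain ⟨m, hm, hm'⟩ := exists_nat_pow_near_of_lt_one (div_pos hv.1 hu)
      ((div_le_one hu).2 hv.2.le) (one_half_pos (α := ℝ)) one_half_lt_one
    rw [lt_div_iff₀' hu] at hm
    rw [div_le_iff₀' hu] at hm'
    exact mem_iUnion.2 ⟨m, hm, hm'⟩
  have hpiece : ∀ m, ∫⁻ v in Ioc (d (m + 1)) (d m), G v ≤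
      ENNReal.ofReal (d (m + 1)) * G (d (m + 1)) := fun m =>
    calc ∫⁻ v in Ioc (d (m + 1)) (d m), G v
        ≤ ∫⁻ _ in Ioc (d (m + 1)) (d m), G (d (m + 1)) :=
          setLIntegral_mono' measurableSet_Ioc fun v hv =>
            hG (hd_pos _) ((hd_pos _).trans hv.1) hv.1.le
      _ = ENNReal.ofReal (d (m + 1)) * G (d (m + 1)) := by
          rw [setLIntegral_const, Real.volume_Ioc, mul_comm]
          congr 2
          ring
  calc hardyMean G u ≤ (ENNReal.ofReal u)⁻¹ * ∑' m, ENNReal.ofReal (d (m + 1)) * G (d (m + 1)) := by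
        rw [hardyMean]
        gcongr
        exact (lintegral_mono_set hcover).trans ((lintegral_iUnion_le _ _).trans
          (ENNReal.tsum_le_tsum hpiece))
    _ = _ := by
        rw [← ENNReal.tsum_mul_left]
        congr with m
        rw [hd, ENNReal.ofReal_mul hu.le, mul_assoc,
          ENNReal.inv_mul_cancel_left (by simpa using hu) ENNReal.ofReal_ne_top]

theorem rpow_mul_hardyMean_le_tsum (hG : AntitoneOn G (Ioi 0)) (β : ℝ) (hu : 0 < u) :
    ENNReal.ofReal (u ^ β) * hardyMean G u ≤
      ∑' m : ℕ, ENNReal.ofReal (((1 / 2) ^ (m + 1)) ^ (1 - β)) *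
        (ENNReal.ofReal ((u * (1 / 2) ^ (m + 1)) ^ β) * G (u * (1 / 2) ^ (m + 1))) := by
  refine (mul_le_mul_right (hardyMean_le_tsum hG hu) _).trans_eq ?_
  rw [← ENNReal.tsum_mul_left]
  congr with m
  have hc : (0 : ℝ) < (1 / 2) ^ (m + 1) := by positivity
  have hpow : u ^ β * (1 / 2) ^ (m + 1) =
      ((1 / 2) ^ (m + 1)) ^ (1 - β) * (u * (1 / 2) ^ (m + 1)) ^ β := by
    rw [Real.mul_rpow hu.le hc.le, mul_left_comm, ← Real.rpow_add hc, sub_add_cancel, Real.rpow_one]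
  rw [← mul_assoc, ← mul_assoc, ← ENNReal.ofReal_mul (by positivity),
    ← ENNReal.ofReal_mul (by positivity), hpow]

variable {q : ℝ≥0∞}

theorem normOn_mul_comp_mul_right_le {c : ℝ} (hc : 0 < c) (hc₁ : c ≤ 1) (δ t : ℝ)
    (F : ℝ → ℝ≥0∞) :
    normOn q (Ioo 0 t) (fun u => ENNReal.ofReal (c ^ δ) * F (u * c)) ≤
      ENNReal.ofReal (c ^ (δ - recip q)) * normOn q (Ioo 0 t) F := by
  have hsub : Ioo 0 (t * c) ⊆ Ioo 0 t := fun x hx =>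
    ⟨hx.1, hx.2.trans_le
      (mul_le_of_le_one_right (pos_of_mul_pos_left (hx.1.trans hx.2) hc.le).le hc₁)⟩
  calc normOn q (Ioo 0 t) (fun u => ENNReal.ofReal (c ^ δ) * F (u * c))
      ≤ ENNReal.ofReal (c ^ δ) * normOn q (Ioo 0 t) (fun u => F (u * c)) :=
        normOn_le_mul measurableSet_Ioo (c ^ δ).toNNReal fun _ _ => le_rfl
    _ = ENNReal.ofReal (c ^ (δ - recip q)) * normOn q (Ioo 0 (t * c)) F := by
        rw [normOn_comp_mul_right hc, ← mul_assoc, ← ENNReal.ofReal_mul (by positivity),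
          ← Real.rpow_add hc, sub_eq_add_neg]
    _ ≤ ENNReal.ofReal (c ^ (δ - recip q)) * normOn q (Ioo 0 t) F := by
        gcongr
        exact eLpNorm_mono_measure F (Measure.restrict_mono hsub le_rfl)

theorem exists_normOn_rpow_mul_hardyMean_le (hq₀ : q ≠ 0) {β : ℝ} (hβ : β + recip q < 1) :
    ∃ C : ℝ≥0, ∀ (t : ℝ) (G : ℝ → ℝ≥0∞), AntitoneOn G (Ioi 0) →
      normOn q (Ioo 0 t) (fun u => ENNReal.ofReal (u ^ β) * hardyMean G u) ≤
        C * normOn q (Ioo 0 t) fun u => ENNReal.ofReal (u ^ β) * G u := by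
  set ρ : ℝ≥0 := ((1 / 2 : ℝ) ^ (1 - β - recip q)).toNNReal
  have hρ : ρ < 1 := Real.toNNReal_lt_one.2
    (Real.rpow_lt_one one_half_pos.le one_half_lt_one (by linarith))
  obtain ⟨C, hC⟩ := exists_eLpNorm_tsum_le_of_geometric (α := ℝ) hq₀ hρ
  refine ⟨C, fun t G hG => ?_⟩
  set w : ℝ → ℝ≥0∞ := fun u => ENNReal.ofReal (u ^ β) * G u
  obtain ⟨c, hc⟩ : ∃ c : ℕ → ℝ, ∀ m, c m = (1 / 2) ^ (m + 1) := ⟨_, fun _ => rfl⟩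
  have hc_pos : ∀ m, 0 < c m := fun m => by rw [hc]; positivity
  have hmeas : ∀ m, AEMeasurable (fun u => ENNReal.ofReal (c m ^ (1 - β)) * w (u * c m))
      (volume.restrict (Ioo 0 t)) := fun m => by
    have hGm : AntitoneOn (fun u => G (u * c m)) (Ioo 0 t) := fun x hx y hy hxy =>
      hG (mul_pos hx.1 (hc_pos m)) (mul_pos hy.1 (hc_pos m))
        (mul_le_mul_of_nonneg_right hxy (hc_pos m).le)
    have hpow : Measurable fun u => ENNReal.ofReal ((u * c m) ^ β) := by fun_prop
    exact (hpow.aemeasurable.mul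
      (aemeasurable_restrict_of_antitoneOn measurableSet_Ioo hGm)).const_mul _
  have hnorm : ∀ m, normOn q (Ioo 0 t) (fun u => ENNReal.ofReal (c m ^ (1 - β)) * w (u * c m)) ≤
      ρ ^ m * normOn q (Ioo 0 t) w := fun m => by
    have hc₁ : c m ≤ 1 := by rw [hc]; exact pow_le_one₀ one_half_pos.le one_half_lt_one.le
    refine (normOn_mul_comp_mul_right_le (hc_pos m) hc₁ _ t w).trans ?_
    gcongr
    rw [hc, ← Real.rpow_pow_comm one_half_pos.le, ENNReal.ofReal_pow (by positivity)]
    exact pow_le_pow_right_of_le_one' (ENNReal.coe_le_one_iff.2 hρ.le) m.le_succ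
  calc normOn q (Ioo 0 t) (fun u => ENNReal.ofReal (u ^ β) * hardyMean G u)
      ≤ (1 : ℝ≥0) * normOn q (Ioo 0 t)
          fun u => ∑' m, ENNReal.ofReal (c m ^ (1 - β)) * w (u * c m) :=
        normOn_le_mul measurableSet_Ioo 1 fun u hu => by
          simpa only [hc, ENNReal.coe_one, one_mul] using rpow_mul_hardyMean_le_tsum hG β hu.1
    _ ≤ C * normOn q (Ioo 0 t) w := by
        rw [ENNReal.coe_one, one_mul]
        exact hC _ _ _ hmeas hnorm

end Hardy

section LimitNorm

theorem ofReal_rpow_mul_weight (s α : ℝ) (a : ℝ → ℝ) {u : ℝ} (hu : 0 < u) :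
    ENNReal.ofReal (u ^ s) * weight α a u = weight (s + α) a u := by
  rw [weight, weight, ← ENNReal.ofReal_mul (by positivity), ← mul_assoc, ← Real.rpow_add hu]

theorem weight_ne_zero (α : ℝ) {a : ℝ → ℝ} {u : ℝ} (hu : 0 < u) (ha : 0 < a u) :
    weight α a u ≠ 0 :=
  (ENNReal.ofReal_pos.2 (mul_pos (Real.rpow_pos_of_pos hu α) ha)).ne'

theorem IsAlmostDecreasing.exists_antitoneOn_equiv {g : ℝ → ℝ} (hg : IsAlmostDecreasing g) :
    ∃ (C : ℝ≥0) (ψ : ℝ → ℝ≥0∞), AntitoneOn ψ (Ioi 0) ∧ ∀ u, 0 < u →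
      ENNReal.ofReal (g u) ≤ C * ψ u ∧ ψ u ≤ C * ENNReal.ofReal (g u) := by
  obtain ⟨φ, hφ, C, hC, hgφ⟩ := hg
  refine ⟨C.toNNReal, fun u => ENNReal.ofReal (φ u),
    fun u hu v hv huv => ENNReal.ofReal_le_ofReal (hφ hu hv huv), fun u hu => ?_⟩
  change _ ≤ ENNReal.ofReal C * _ ∧ _ ≤ ENNReal.ofReal C * _
  rw [← ENNReal.ofReal_mul hC.le, ← ENNReal.ofReal_mul hC.le]
  exact (hgφ u hu).imp ENNReal.ofReal_le_ofReal ENNReal.ofReal_le_ofReal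

variable {q r : ℝ≥0∞} {a b : ℝ → ℝ} {α ε : ℝ} {g h : ℝ → ℝ≥0∞}

theorem exists_normOn_weight_mul_hardyMean_le (hq₀ : q ≠ 0)
    (ha : IsAlmostDecreasing fun t => t ^ (-ε) * a t) (hα : α + ε + recip q < 1) :
    ∃ C : ℝ≥0, ∀ (t : ℝ) (G : ℝ → ℝ≥0∞), AntitoneOn G (Ioi 0) →
      normOn q (Ioo 0 t) (fun u => weight α a u * hardyMean G u) ≤
        C * normOn q (Ioo 0 t) fun u => weight α a u * G u := by
  obtain ⟨C, ψ, hψ, hC⟩ := ha.exists_antitoneOn_equiv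
  obtain ⟨D, hD⟩ := exists_normOn_rpow_mul_hardyMean_le hq₀ hα
  have hweight : ∀ u, 0 < u → ENNReal.ofReal (u ^ (α + ε)) * weight (-ε) a u = weight α a u :=
    fun u hu => by rw [ofReal_rpow_mul_weight _ _ _ hu, add_neg_cancel_right]
  refine ⟨C * (D * C), fun t G hG => ?_⟩
  have hmean : ∀ u, 0 < u →
      weight (-ε) a u * hardyMean G u ≤ C * hardyMean (fun v => ψ v * G v) u := fun u hu =>
    calc weight (-ε) a u * hardyMean G u ≤ C * ψ u * hardyMean G u := by
          gcongr
          exact (hC u hu).1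
      _ ≤ C * hardyMean (fun v => ψ v * G v) u := by
          rw [mul_assoc]
          gcongr
          exact mul_hardyMean_le hψ G hu
  calc normOn q (Ioo 0 t) (fun u => weight α a u * hardyMean G u)
      ≤ C * normOn q (Ioo 0 t)
          (fun u => ENNReal.ofReal (u ^ (α + ε)) * hardyMean (fun v => ψ v * G v) u) :=
        normOn_le_mul measurableSet_Ioo C fun u hu => by
          rw [← hweight u hu.1, mul_assoc, mul_left_comm (C : ℝ≥0∞)]
          exact mul_le_mul_right (hmean u hu.1) _
    _ ≤ C * (D * normOn q (Ioo 0 t) fun u => ENNReal.ofReal (u ^ (α + ε)) * (ψ u * G u)) := by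
        gcongr
        exact hD t _ (hψ.mul' hG)
    _ ≤ C * (D * (C * normOn q (Ioo 0 t) fun u => weight α a u * G u)) := by
        gcongr
        refine normOn_le_mul measurableSet_Ioo C fun u hu => ?_
        rw [← hweight u hu.1, mul_assoc, mul_left_comm (C : ℝ≥0∞), ← mul_assoc (C : ℝ≥0∞)]
        gcongr
        exact (hC u hu.1).2
    _ = (C * (D * C) : ℝ≥0) * normOn q (Ioo 0 t) fun u => weight α a u * G u := by
        push_cast
        ring

/-- The functional `‖t^{-1/r} b(t) ‖u^α a(u) g(u)‖_{q,(0,t)}‖_{r,(0,∞)}`, from which the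
quasi-norms of all the spaces in question arise for `g = K(·,f)`, `f*` or `f**`. -/
def limitNorm (r : ℝ≥0∞) (b : ℝ → ℝ) (q : ℝ≥0∞) (a : ℝ → ℝ) (α : ℝ) (g : ℝ → ℝ≥0∞) : ℝ≥0∞ :=
  normOn r (Ioi 0) fun t => weight (-recip r) b t *
    normOn q (Ioo 0 t) fun u => weight α a u * g u

theorem limitNorm_le_mul_of_normOn_le (C : ℝ≥0)
    (hgh : ∀ t, 0 < t → normOn q (Ioo 0 t) (fun u => weight α a u * g u) ≤
      C * normOn q (Ioo 0 t) fun u => weight α a u * h u) :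
    limitNorm r b q a α g ≤ C * limitNorm r b q a α h :=
  normOn_le_mul measurableSet_Ioi C fun t ht => by
    rw [mul_left_comm]
    gcongr
    exact hgh t ht

theorem limitNorm_le_mul (C : ℝ≥0) (hgh : ∀ u, 0 < u → g u ≤ C * h u) :
    limitNorm r b q a α g ≤ C * limitNorm r b q a α h :=
  limitNorm_le_mul_of_normOn_le C fun t _ => normOn_le_mul measurableSet_Ioo C fun u hu => by
    rw [mul_left_comm]
    gcongr
    exact hgh u hu.1

theorem limitNorm_ofReal_mul :
    limitNorm r b q a α (fun u => ENNReal.ofReal u * g u) = limitNorm r b q a (1 + α) g := by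
  unfold limitNorm
  congr with t
  congr 1
  refine eLpNorm_congr_ae (ae_restrict_of_forall_mem measurableSet_Ioo fun u hu => ?_)
  beta_reduce
  rw [← ofReal_rpow_mul_weight _ _ _ hu.1, Real.rpow_one, mul_assoc, mul_left_comm]

theorem exists_ne_top_of_limitNorm_lt_top (hq₀ : q ≠ 0) (hr₀ : r ≠ 0)
    (ha : ∀ t, 0 < t → 0 < a t) (hb : ∀ t, 0 < t → 0 < b t) (hg : limitNorm r b q a α g < ∞) :
    ∃ u, 0 < u ∧ g u ≠ ∞ := by
  obtain ⟨t, ht, houter⟩ := exists_ne_top_of_normOn_lt_top hr₀ measurableSet_Ioi (by simp) hg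
  have hinner : normOn q (Ioo 0 t) (fun u => weight α a u * g u) < ∞ :=
    ENNReal.lt_top_of_mul_ne_top_right houter (weight_ne_zero _ ht (hb t ht))
  obtain ⟨u, hu, hfin⟩ := exists_ne_top_of_normOn_lt_top hq₀ measurableSet_Ioo
    (by simpa using ht) hinner
  exact ⟨u, hu.1, (ENNReal.lt_top_of_mul_ne_top_right hfin
    (weight_ne_zero _ hu.1 (ha u hu.1))).ne⟩

theorem exists_limitNorm_hardyMean_le (hq₀ : q ≠ 0)
    (ha : IsAlmostDecreasing fun t => t ^ (-ε) * a t) (hα : α + ε + recip q < 1) :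
    ∃ C : ℝ≥0, ∀ G : ℝ → ℝ≥0∞, AntitoneOn G (Ioi 0) →
      limitNorm r b q a α (hardyMean G) ≤ C * limitNorm r b q a α G := by
  obtain ⟨C, hC⟩ := exists_normOn_weight_mul_hardyMean_le hq₀ ha hα
  exact ⟨C, fun G hG => limitNorm_le_mul_of_normOn_le C fun t _ => hC t G hG⟩

end LimitNorm

section Embeddings

theorem FnSpace.Embeds.refl {V : Type*} (X : FnSpace V) : X.Embeds X :=
  ⟨Subset.rfl, 1, fun f _ => by simp⟩

theorem FnSpace.Embeds.trans {V : Type*} {X Y Z : FnSpace V} (hXY : X.Embeds Y)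
    (hYZ : Y.Embeds Z) : X.Embeds Z := by
  obtain ⟨hXY, C, hC⟩ := hXY
  obtain ⟨hYZ, D, hD⟩ := hYZ
  refine ⟨hXY.trans hYZ, D * C, fun f hf => ?_⟩
  calc Z.qnorm f ≤ D * Y.qnorm f := hD f (hXY hf)
    _ ≤ D * (C * X.qnorm f) := by gcongr; exact hC f hf
    _ = (D * C : ℝ≥0) * X.qnorm f := by push_cast; ring

theorem FnSpace.embeds_ofQNorm {V : Type*} {X : FnSpace V} {N : V → ℝ≥0∞}
    (hX : ∀ f ∈ X.carrier, X.qnorm f < ∞) (C : ℝ≥0) (hN : ∀ f ∈ X.carrier, N f ≤ C * X.qnorm f) :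
    X.Embeds (.ofQNorm N) :=
  ⟨fun f hf => (hN f hf).trans_lt (ENNReal.mul_lt_top ENNReal.coe_lt_top (hX f hf)), C, hN⟩

variable {V : Type*} [AddCommGroup V] {A₀ A₁ B₀ B₁ : FnSpace V}

theorem peetreK_le {f f₀ f₁ : V} (h₀ : f₀ ∈ A₀.carrier) (h₁ : f₁ ∈ A₁.carrier) (hf : f = f₀ + f₁)
    (t : ℝ) : peetreK A₀ A₁ t f ≤ A₀.qnorm f₀ + ENNReal.ofReal t * A₁.qnorm f₁ :=
  iInf₂_le_of_le f₀ h₀ (iInf₂_le_of_le f₁ h₁ (iInf_le _ hf))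

theorem sumSet_mono (h₀ : A₀.carrier ⊆ B₀.carrier) (h₁ : A₁.carrier ⊆ B₁.carrier) :
    sumSet A₀ A₁ ⊆ sumSet B₀ B₁ := by
  rintro f ⟨f₀, hf₀, f₁, hf₁, hf⟩
  exact ⟨f₀, h₀ hf₀, f₁, h₁ hf₁, hf⟩

theorem exists_peetreK_le_mul (h₀ : A₀.Embeds B₀) (h₁ : A₁.Embeds B₁) :
    ∃ C : ℝ≥0, ∀ t f, peetreK B₀ B₁ t f ≤ C * peetreK A₀ A₁ t f := by
  obtain ⟨h₀, C₀, hC₀⟩ := h₀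
  obtain ⟨h₁, C₁, hC₁⟩ := h₁
  set C : ℝ≥0 := 1 + C₀ + C₁
  have hC : (C : ℝ≥0∞) ≠ 0 := by simp [C]
  have hC₀C : (C₀ : ℝ≥0∞) ≤ C := by simp [C, add_comm, add_left_comm]
  have hC₁C : (C₁ : ℝ≥0∞) ≤ C := by simp [C]
  refine ⟨C, fun t f => ?_⟩
  rw [← ENNReal.inv_mul_le_iff hC ENNReal.coe_ne_top]
  refine le_iInf₂ fun f₀ hf₀ => le_iInf₂ fun f₁ hf₁ => le_iInf fun hf => ?_
  rw [ENNReal.inv_mul_le_iff hC ENNReal.coe_ne_top]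
  calc peetreK B₀ B₁ t f ≤ B₀.qnorm f₀ + ENNReal.ofReal t * B₁.qnorm f₁ :=
        peetreK_le (h₀ hf₀) (h₁ hf₁) hf t
    _ ≤ C * A₀.qnorm f₀ + ENNReal.ofReal t * (C * A₁.qnorm f₁) := by
        gcongr
        · exact (hC₀ f₀ hf₀).trans (by gcongr)
        · exact (hC₁ f₁ hf₁).trans (by gcongr)
    _ = C * (A₀.qnorm f₀ + ENNReal.ofReal t * A₁.qnorm f₁) := by ring

theorem FnSpace.Embeds.interpL (h₀ : A₀.Embeds B₀) (h₁ : A₁.Embeds B₁) (θ : ℝ) (r : ℝ≥0∞)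
    (b : ℝ → ℝ) (q : ℝ≥0∞) (a : ℝ → ℝ) :
    (interpL A₀ A₁ θ r b q a).Embeds (interpL B₀ B₁ θ r b q a) := by
  obtain ⟨C, hC⟩ := exists_peetreK_le_mul h₀ h₁
  have hnorm : ∀ f, interpLNorm B₀ B₁ θ r b q a f ≤ C * interpLNorm A₀ A₁ θ r b q a f :=
    fun f => limitNorm_le_mul C fun u _ => hC u f
  exact ⟨fun f hf => ⟨sumSet_mono h₀.1 h₁.1 hf.1,
    (hnorm f).trans_lt (ENNReal.mul_lt_top ENNReal.coe_lt_top hf.2)⟩, C, fun f _ => hnorm f⟩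

end Embeddings

section Rearrangement

theorem lintegral_eq_lintegral_measure_ofReal_lt {α : Type*} [MeasurableSpace α] {ν : Measure α}
    {g : α → ℝ≥0∞} (hg : AEMeasurable g ν) :
    ∫⁻ x, g x ∂ν = ∫⁻ s in Ioi 0, ν {x | ENNReal.ofReal s < g x} := by
  by_cases htop : ν {x | g x = ∞} = 0
  · have hfin : ∀ᵐ x ∂ν, g x ≠ ∞ := by simpa [ae_iff] using htop
    calc ∫⁻ x, g x ∂ν = ∫⁻ x, ENNReal.ofReal (g x).toReal ∂ν :=
          lintegral_congr_ae (hfin.mono fun x hx => (ENNReal.ofReal_toReal hx).symm)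
      _ = ∫⁻ s in Ioi 0, ν {x | s < (g x).toReal} :=
          lintegral_eq_lintegral_meas_lt ν (.of_forall fun _ => ENNReal.toReal_nonneg)
            hg.ennreal_toReal
      _ = ∫⁻ s in Ioi 0, ν {x | ENNReal.ofReal s < g x} :=
          setLIntegral_congr_fun measurableSet_Ioi fun s hs => measure_congr <|
            hfin.mono fun x hx => propext (ENNReal.ofReal_lt_iff_lt_toReal (le_of_lt hs) hx).symm
  · rw [lintegral_eq_top_of_measure_eq_top_ne_zero hg htop, eq_comm, eq_top_iff]
    calc ∞ = ∫⁻ _ in Ioi (0 : ℝ), ν {x | g x = ∞} := by simp [ENNReal.mul_top htop]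
      _ ≤ ∫⁻ s in Ioi 0, ν {x | ENNReal.ofReal s < g x} := lintegral_mono fun s =>
          measure_mono fun x (hx : g x = ∞) => by simp [hx]

variable {Ω : Type*} [MeasurableSpace Ω] {μ : Measure Ω} {𝕜 : Type*} [RCLike 𝕜]
  {f f₀ : Ω →ₘ[μ] 𝕜} {t : ℝ}

theorem rearr_antitone (f : Ω →ₘ[μ] 𝕜) : Antitone (rearr f) := fun _ _ h =>
  sInf_le_sInf fun _ hs => le_trans hs (ENNReal.ofReal_le_ofReal h)

theorem measure_rearr_lt_le (f : Ω →ₘ[μ] 𝕜) (t : ℝ) :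
    μ {x | rearr f t < ‖f x‖ₑ} ≤ ENNReal.ofReal t := by
  rcases eq_or_ne (rearr f t) ∞ with htop | htop
  · simp [htop]
  obtain ⟨s, hs, hs_mem, hlim⟩ := exists_seq_strictAnti_tendsto' (lt_top_iff_ne_top.2 htop)
  have hunion : {x | rearr f t < ‖f x‖ₑ} = ⋃ n, {x | s n < ‖f x‖ₑ} := by
    ext x
    rw [mem_iUnion]
    exact ⟨fun hx => (hlim.eventually (gt_mem_nhds hx)).exists,
      fun ⟨n, hn⟩ => (hs_mem n).1.trans hn⟩
  have hmono : Monotone fun n => {x | s n < ‖f x‖ₑ} := fun m n hmn x hx =>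
    (hs.antitone hmn).trans_lt hx
  rw [hunion, hmono.measure_iUnion]
  refine iSup_le fun n => ?_
  obtain ⟨v, hv, hvn⟩ := sInf_lt_iff.1 (hs_mem n).1
  exact (measure_mono fun x hx => hvn.trans hx).trans hv

theorem lt_rearr_iff (f : Ω →ₘ[μ] 𝕜) (t : ℝ) (s : ℝ≥0∞) :
    s < rearr f t ↔ ENNReal.ofReal t < μ {x | s < ‖f x‖ₑ} := by
  rw [← not_iff_not, not_lt, not_lt]
  exact ⟨fun h => (measure_mono fun x hx => h.trans_lt hx).trans (measure_rearr_lt_le f t),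
    fun h => sInf_le h⟩

theorem rearr_mono (hle : ∀ᵐ x ∂μ, ‖f₀ x‖ₑ ≤ ‖f x‖ₑ) (t : ℝ) : rearr f₀ t ≤ rearr f t :=
  sInf_le ((measure_mono_ae (hle.mono fun _ hx hlt => lt_of_lt_of_le hlt hx)).trans
    (measure_rearr_lt_le f t))

theorem rearr_add_le (f₀ f₁ : Ω →ₘ[μ] 𝕜) (t : ℝ) :
    rearr (f₀ + f₁) t ≤ rearr f₀ t + eLpNorm f₁ ∞ μ := by
  refine sInf_le (le_trans (measure_mono_ae ?_) (measure_rearr_lt_le f₀ t))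
  filter_upwards [AEEqFun.coeFn_add f₀ f₁, ae_le_eLpNormEssSup (f := f₁) (μ := μ)] with x hadd hle
  refine fun (hlt : _ < _) => lt_of_not_ge (α := ℝ≥0∞) fun hge => hlt.not_ge ?_
  rw [hadd, eLpNorm_exponent_top]
  exact (enorm_add_le _ _).trans (add_le_add hge hle)

theorem volume_lt_rearr (f : Ω →ₘ[μ] 𝕜) (s : ℝ≥0∞) :
    volume.restrict (Ioi 0) {u | s < rearr f u} = μ {x | s < ‖f x‖ₑ} := by
  simp only [lt_rearr_iff]
  generalize μ {x | s < ‖f x‖ₑ} = m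
  rw [Measure.restrict_apply' measurableSet_Ioi]
  rcases eq_or_ne m ∞ with rfl | hm
  · simp
  · have hIoo : {u | ENNReal.ofReal u < m} ∩ Ioi 0 = Ioo 0 m.toReal := by
      ext u
      rw [inter_comm]
      exact and_congr_right fun hu => ENNReal.ofReal_lt_iff_lt_toReal (le_of_lt hu) hm
    rw [hIoo, Real.volume_Ioo, sub_zero, ENNReal.ofReal_toReal hm]

theorem lintegral_rearr (f : Ω →ₘ[μ] 𝕜) : ∫⁻ u in Ioi 0, rearr f u = eLpNorm f 1 μ := by
  rw [eLpNorm_one_eq_lintegral_enorm,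
    lintegral_eq_lintegral_measure_ofReal_lt (rearr_antitone f).measurable.aemeasurable,
    lintegral_eq_lintegral_measure_ofReal_lt f.stronglyMeasurable.enorm.aemeasurable]
  simp only [volume_lt_rearr]

theorem rearr_eq_zero (hf : μ {x | f x ≠ 0} ≤ ENNReal.ofReal t) : rearr f t = 0 :=
  le_zero_iff.1 (sInf_le (by simpa using hf))

theorem eLpNorm_one_le_setLIntegral_rearr (hle : ∀ᵐ x ∂μ, ‖f₀ x‖ₑ ≤ ‖f x‖ₑ)
    (hsupp : μ {x | f₀ x ≠ 0} ≤ ENNReal.ofReal t) :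
    eLpNorm f₀ 1 μ ≤ ∫⁻ u in Ioo 0 t, rearr f u := by
  have hzero : ∀ u, t ≤ u → rearr f₀ u = 0 := fun u hu =>
    rearr_eq_zero (hsupp.trans (ENNReal.ofReal_le_ofReal hu))
  calc eLpNorm f₀ 1 μ = ∫⁻ u in Ioi 0, rearr f₀ u := (lintegral_rearr f₀).symm
    _ ≤ ∫⁻ u in Ioi 0, (Iio t).indicator (rearr f) u := lintegral_mono fun u => by
        by_cases hu : u < t
        · rw [indicator_of_mem (mem_Iio.2 hu)]
          exact rearr_mono hle u
        · simp [hzero u (not_lt.1 hu)]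
    _ = ∫⁻ u in Ioo 0 t, rearr f u := by
        rw [setLIntegral_indicator measurableSet_Iio, inter_comm, Ioi_inter_Iio]

theorem exists_eq_add_eLpNorm_le_rearr (f : Ω →ₘ[μ] 𝕜) (t : ℝ) :
    ∃ f₀ f₁ : Ω →ₘ[μ] 𝕜, f = f₀ + f₁ ∧
      eLpNorm f₀ 1 μ ≤ ∫⁻ u in Ioo 0 t, rearr f u ∧ eLpNorm f₁ ∞ μ ≤ rearr f t := by
  set E := {x | rearr f t < ‖f x‖ₑ}
  have hE : MeasurableSet E := measurableSet_lt measurable_const f.stronglyMeasurable.enorm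
  have h₀ : AEStronglyMeasurable (E.indicator f) μ :=
    (f.stronglyMeasurable.indicator hE).aestronglyMeasurable
  have h₁ : AEStronglyMeasurable (Eᶜ.indicator f) μ :=
    (f.stronglyMeasurable.indicator hE.compl).aestronglyMeasurable
  refine ⟨AEEqFun.mk _ h₀, AEEqFun.mk _ h₁, ?_, eLpNorm_one_le_setLIntegral_rearr ?_ ?_, ?_⟩
  · simp only [AEEqFun.mk_add_mk, indicator_self_add_compl, AEEqFun.mk_coeFn]
  · filter_upwards [AEEqFun.coeFn_mk _ h₀] with x hx
    rw [hx]
    exact enorm_indicator_le_enorm_self _ _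
  · refine (measure_mono_ae ?_).trans (measure_rearr_lt_le f t)
    filter_upwards [AEEqFun.coeFn_mk _ h₀] with x hx
    exact fun hne => mem_of_indicator_ne_zero (s := E) (f := f) fun hzero => hne (hx.trans hzero)
  · rw [eLpNorm_congr_ae (AEEqFun.coeFn_mk _ h₁), eLpNorm_exponent_top]
    refine eLpNormEssSup_le_of_ae_enorm_bound (.of_forall fun x => ?_)
    by_cases hx : x ∈ E
    · simp [hx]
    · rw [indicator_of_mem (mem_compl hx)]
      exact not_lt.1 hx

end Rearrangement

section Spaces

variable {Ω : Type*} [MeasurableSpace Ω] {μ : Measure Ω} {𝕜 : Type*} [RCLike 𝕜] {t : ℝ}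

theorem maxRearr_eq_hardyMean (f : Ω →ₘ[μ] 𝕜) : maxRearr f = hardyMean (rearr f) := rfl

theorem ofReal_mul_rearr_le_eLpNorm_one (f : Ω →ₘ[μ] 𝕜) (ht : 0 < t) :
    ENNReal.ofReal t * rearr f t ≤ eLpNorm f 1 μ :=
  calc ENNReal.ofReal t * rearr f t ≤ ENNReal.ofReal t * hardyMean (rearr f) t := by
        gcongr
        exact le_hardyMean ((rearr_antitone f).antitoneOn _) ht
    _ = ∫⁻ u in Ioo 0 t, rearr f u := ofReal_mul_hardyMean _ ht
    _ ≤ ∫⁻ u in Ioi 0, rearr f u := lintegral_mono_set Ioo_subset_Ioi_self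
    _ = eLpNorm f 1 μ := lintegral_rearr f

theorem weakL1_qnorm (f : Ω →ₘ[μ] 𝕜) :
    (weakL1 μ 𝕜).qnorm f = normOn ∞ (Ioi 0) fun t => ENNReal.ofReal t * rearr f t := by
  simp [weakL1, lorentzKaramata, FnSpace.ofQNorm, weight, recip]

theorem lebesgue_one_embeds_weakL1 : (lebesgue μ 𝕜 1).Embeds (weakL1 μ 𝕜) := by
  refine FnSpace.embeds_ofQNorm (fun f hf => hf) 1 fun f _ => ?_
  rw [ENNReal.coe_one, one_mul]
  refine (weakL1_qnorm f).trans_le ?_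
  rw [normOn, eLpNorm_exponent_top]
  exact eLpNormEssSup_le_of_ae_enorm_bound (ae_restrict_of_forall_mem measurableSet_Ioi
    fun t ht => ofReal_mul_rearr_le_eLpNorm_one f ht)

theorem ofReal_mul_rearr_le_peetreK (f : Ω →ₘ[μ] 𝕜) (ht : 0 < t) :
    ENNReal.ofReal t * rearr f t ≤ peetreK (weakL1 μ 𝕜) (lebesgue μ 𝕜 ∞) t f := by
  refine le_iInf₂ fun f₀ _ => le_iInf₂ fun f₁ _ => le_iInf fun hf => ?_
  calc ENNReal.ofReal t * rearr f t
      ≤ ENNReal.ofReal t * (rearr f₀ t + eLpNorm f₁ ∞ μ) := by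
        rw [hf]
        gcongr
        exact rearr_add_le f₀ f₁ t
    _ = ENNReal.ofReal t * rearr f₀ t + ENNReal.ofReal t * eLpNorm f₁ ∞ μ := mul_add _ _ _
    _ ≤ (weakL1 μ 𝕜).qnorm f₀ + ENNReal.ofReal t * (lebesgue μ 𝕜 ∞).qnorm f₁ := by
        rw [weakL1_qnorm]
        gcongr
        · exact ofReal_mul_le_normOn_top_of_antitoneOn ((rearr_antitone f₀).antitoneOn _) ht
        · exact le_rfl

theorem exists_eq_add_of_maxRearr_ne_top (f : Ω →ₘ[μ] 𝕜) (ht : 0 < t) (hf : maxRearr f t ≠ ∞) :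
    ∃ f₀ ∈ (lebesgue μ 𝕜 1).carrier, ∃ f₁ ∈ (lebesgue μ 𝕜 ∞).carrier, f = f₀ + f₁ ∧
      eLpNorm f₀ 1 μ ≤ ENNReal.ofReal t * maxRearr f t ∧ eLpNorm f₁ ∞ μ ≤ maxRearr f t := by
  obtain ⟨f₀, f₁, hadd, h₀, h₁⟩ := exists_eq_add_eLpNorm_le_rearr f t
  rw [← ofReal_mul_hardyMean _ ht, ← maxRearr_eq_hardyMean] at h₀
  replace h₁ := h₁.trans (le_hardyMean ((rearr_antitone f).antitoneOn _) ht)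
  exact ⟨f₀, h₀.trans_lt (ENNReal.mul_lt_top ENNReal.ofReal_lt_top hf.lt_top),
    f₁, h₁.trans_lt hf.lt_top, hadd, h₀, h₁⟩

theorem peetreK_le_two_mul_maxRearr (f : Ω →ₘ[μ] 𝕜) (ht : 0 < t) :
    peetreK (lebesgue μ 𝕜 1) (lebesgue μ 𝕜 ∞) t f ≤
      (2 : ℝ≥0) * (ENNReal.ofReal t * maxRearr f t) := by
  by_cases hf : maxRearr f t = ∞
  · simp [hf, ENNReal.mul_top, ht]
  obtain ⟨f₀, hf₀, f₁, hf₁, hadd, h₀, h₁⟩ := exists_eq_add_of_maxRearr_ne_top f ht hf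
  calc peetreK (lebesgue μ 𝕜 1) (lebesgue μ 𝕜 ∞) t f
      ≤ eLpNorm f₀ 1 μ + ENNReal.ofReal t * eLpNorm f₁ ∞ μ := peetreK_le hf₀ hf₁ hadd t
    _ ≤ ENNReal.ofReal t * maxRearr f t + ENNReal.ofReal t * maxRearr f t := by gcongr
    _ = (2 : ℝ≥0) * (ENNReal.ofReal t * maxRearr f t) := by push_cast; ring

variable {p q r : ℝ≥0∞} {θ ε : ℝ} {a b : ℝ → ℝ}

theorem interpL_weakL1_embeds_lorentzL (hp : recip p = 1 - θ) :
    (interpL (weakL1 μ 𝕜) (lebesgue μ 𝕜 ∞) θ r b q a).Embeds (lorentzL μ 𝕜 p r b q a) := by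
  refine FnSpace.embeds_ofQNorm (fun f hf => hf.2) 1 fun f _ => ?_
  have hexp : recip p - recip q = 1 + (-θ - recip q) := by rw [hp]; ring
  calc limitNorm r b q a (recip p - recip q) (rearr f)
      = limitNorm r b q a (-θ - recip q) fun u => ENNReal.ofReal u * rearr f u := by
        rw [limitNorm_ofReal_mul, hexp]
    _ ≤ (1 : ℝ≥0) * limitNorm r b q a (-θ - recip q)
          fun u => peetreK (weakL1 μ 𝕜) (lebesgue μ 𝕜 ∞) u f :=
        limitNorm_le_mul 1 fun u hu => by simpa using ofReal_mul_rearr_le_peetreK f hu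

theorem lorentzL_embeds_maxLorentzL (hq₀ : q ≠ 0) (hp : recip p + ε < 1)
    (ha : IsAlmostDecreasing fun t => t ^ (-ε) * a t) :
    (lorentzL μ 𝕜 p r b q a).Embeds (maxLorentzL μ 𝕜 p r b q a) := by
  obtain ⟨C, hC⟩ := exists_limitNorm_hardyMean_le (r := r) (b := b) hq₀ ha
    (α := recip p - recip q) (by linarith)
  exact FnSpace.embeds_ofQNorm (fun f hf => hf) C fun f _ =>
    hC (rearr f) ((rearr_antitone f).antitoneOn _)

theorem maxLorentzL_embeds_interpL_lebesgue (hp : recip p = 1 - θ) (hq₀ : q ≠ 0) (hr₀ : r ≠ 0)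
    (ha : ∀ t, 0 < t → 0 < a t) (hb : ∀ t, 0 < t → 0 < b t) :
    (maxLorentzL μ 𝕜 p r b q a).Embeds
      (interpL (lebesgue μ 𝕜 1) (lebesgue μ 𝕜 ∞) θ r b q a) := by
  have hnorm : ∀ f, interpLNorm (lebesgue μ 𝕜 1) (lebesgue μ 𝕜 ∞) θ r b q a f ≤
      (2 : ℝ≥0) * (maxLorentzL μ 𝕜 p r b q a).qnorm f := fun f => by
    have hexp : recip p - recip q = 1 + (-θ - recip q) := by rw [hp]; ring
    calc limitNorm r b q a (-θ - recip q)
            (fun u => peetreK (lebesgue μ 𝕜 1) (lebesgue μ 𝕜 ∞) u f)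
        ≤ (2 : ℝ≥0) * limitNorm r b q a (-θ - recip q)
            (fun u => ENNReal.ofReal u * maxRearr f u) :=
          limitNorm_le_mul 2 fun u hu => peetreK_le_two_mul_maxRearr f hu
      _ = (2 : ℝ≥0) * limitNorm r b q a (recip p - recip q) (maxRearr f) := by
          rw [limitNorm_ofReal_mul, hexp]
  refine ⟨fun f hf => ⟨?_, (hnorm f).trans_lt (ENNReal.mul_lt_top ENNReal.coe_lt_top hf)⟩,
    2, fun f _ => hnorm f⟩
  obtain ⟨u, hu, hfin⟩ := exists_ne_top_of_limitNorm_lt_top hq₀ hr₀ ha hb hf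
  obtain ⟨f₀, h₀, f₁, h₁, hadd, -⟩ := exists_eq_add_of_maxRearr_ne_top f hu hfin
  exact ⟨f₀, h₀, f₁, h₁, hadd⟩

theorem smallStar_eq_lorentzL (p q r : ℝ≥0∞) (b : ℝ → ℝ) :
    smallStar μ 𝕜 p q r b = lorentzL μ 𝕜 p r b q fun _ => 1 := by
  simp [smallStar, lorentzL, weight]

theorem smallStarStar_eq_maxLorentzL (p q r : ℝ≥0∞) (b : ℝ → ℝ) :
    smallStarStar μ 𝕜 p q r b = maxLorentzL μ 𝕜 p r b q fun _ => 1 := by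
  simp [smallStarStar, maxLorentzL, weight]

theorem isSlowlyVarying_one : IsSlowlyVarying fun _ => 1 where
  pos _ _ := one_pos
  aemeasurable := aemeasurable_const
  equiv_increasing ε hε := ⟨fun t => t ^ ε,
    fun _ hs _ _ hst => Real.rpow_le_rpow (le_of_lt hs) hst hε.le, 1, one_pos, fun t _ => by simp⟩
  equiv_decreasing ε hε := ⟨fun t => t ^ (-ε),
    fun _ hs _ _ hst => Real.rpow_le_rpow_of_nonpos hs hst (by linarith), 1, one_pos,
    fun t _ => by simp⟩

end Spaces

end LimitInterp

end

open LimitInterp in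
theorem theorem6p3_general {Ω : Type*} [MeasurableSpace Ω] (μ : Measure Ω) (𝕜 : Type*) [RCLike 𝕜]
    {θ ε : ℝ} (hθ₁ : θ ≤ 1) (hε : ε < θ) {p : ℝ≥0∞} (hp : p = 1 / ENNReal.ofReal (1 - θ))
    {q r : ℝ≥0∞} (hq : 0 < q) (hr : 0 < r) {a b : ℝ → ℝ} (ha : ∀ t, 0 < t → 0 < a t)
    (ha_dec : IsAlmostDecreasing fun t => t ^ (-ε) * a t) (hb : ∀ t, 0 < t → 0 < b t) :
    (interpL (lebesgue μ 𝕜 1) (lebesgue μ 𝕜 ∞) θ r b q a).Same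
        (interpL (weakL1 μ 𝕜) (lebesgue μ 𝕜 ∞) θ r b q a) ∧
      (interpL (weakL1 μ 𝕜) (lebesgue μ 𝕜 ∞) θ r b q a).Same (maxLorentzL μ 𝕜 p r b q a) ∧
      (maxLorentzL μ 𝕜 p r b q a).Same (lorentzL μ 𝕜 p r b q a) := by
  have hp' : recip p = 1 - θ := by
    rw [recip, hp, one_div, inv_inv, ENNReal.toReal_ofReal (by linarith)]
  have strong_weak := lebesgue_one_embeds_weakL1.interpL (.refl (lebesgue μ 𝕜 ∞)) θ r b q a
  have weak_star := interpL_weakL1_embeds_lorentzL (μ := μ) (𝕜 := 𝕜) (r := r) (b := b) (q := q)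
    (a := a) hp'
  have star_max := lorentzL_embeds_maxLorentzL (μ := μ) (𝕜 := 𝕜) (r := r) (b := b) (p := p)
    hq.ne' (by linarith) ha_dec
  have max_strong := maxLorentzL_embeds_interpL_lebesgue (μ := μ) (𝕜 := 𝕜) hp' hq.ne' hr.ne' ha hb
  exact ⟨⟨strong_weak, weak_star.trans (star_max.trans max_strong)⟩,
    ⟨weak_star.trans star_max, max_strong.trans strong_weak⟩,
    ⟨max_strong.trans (strong_weak.trans weak_star), star_max⟩⟩

theorem theorem6p3 {Ω : Type*} [MeasurableSpace Ω] (μ : Measure Ω) [SigmaFinite μ]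
    (hμ : LimitInterp.IsNonatomic μ) (𝕜 : Type*) [RCLike 𝕜]
    (θ : ℝ) (hθ₀ : 0 < θ) (hθ₁ : θ ≤ 1)
    (p : ℝ≥0∞) (hp : p = 1 / ENNReal.ofReal (1 - θ))
    (q r : ℝ≥0∞) (hq : 0 < q) (hr : 0 < r)
    (a b : ℝ → ℝ) (ha : LimitInterp.IsSlowlyVarying a) (hb : LimitInterp.IsSlowlyVarying b) :
    ((LimitInterp.interpL (LimitInterp.lebesgue μ 𝕜 1) (LimitInterp.lebesgue μ 𝕜 ∞) θ r b q a).Same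
        (LimitInterp.interpL (LimitInterp.weakL1 μ 𝕜) (LimitInterp.lebesgue μ 𝕜 ∞) θ r b q a) ∧
      (LimitInterp.interpL (LimitInterp.weakL1 μ 𝕜) (LimitInterp.lebesgue μ 𝕜 ∞) θ r b q a).Same
        (LimitInterp.maxLorentzL μ 𝕜 p r b q a) ∧
      (LimitInterp.maxLorentzL μ 𝕜 p r b q a).Same (LimitInterp.lorentzL μ 𝕜 p r b q a)) ∧
    ((LimitInterp.interpL (LimitInterp.lebesgue μ 𝕜 1) (LimitInterp.lebesgue μ 𝕜 ∞)
          θ r b q (fun _ => 1)).Same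
        (LimitInterp.interpL (LimitInterp.weakL1 μ 𝕜) (LimitInterp.lebesgue μ 𝕜 ∞)
          θ r b q (fun _ => 1)) ∧
      (LimitInterp.interpL (LimitInterp.weakL1 μ 𝕜) (LimitInterp.lebesgue μ 𝕜 ∞)
          θ r b q (fun _ => 1)).Same (LimitInterp.smallStarStar μ 𝕜 p q r b) ∧
      (LimitInterp.smallStarStar μ 𝕜 p q r b).Same (LimitInterp.smallStar μ 𝕜 p q r b)) := by
  have hdec {c : ℝ → ℝ} (hc : LimitInterp.IsSlowlyVarying c) :=
    hc.equiv_decreasing (θ / 2) (half_pos hθ₀)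
  refine ⟨theorem6p3_general μ 𝕜 hθ₁ (half_lt_self hθ₀) hp hq hr ha.pos (hdec ha) hb.pos, ?_⟩
  rw [LimitInterp.smallStarStar_eq_maxLorentzL, LimitInterp.smallStar_eq_lorentzL]
  exact theorem6p3_general μ 𝕜 hθ₁ (half_lt_self hθ₀) hp hq hr
    LimitInterp.isSlowlyVarying_one.pos (hdec LimitInterp.isSlowlyVarying_one) hb.pos
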